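/- Let $\mathcal H$ be a finite-dimensional complex Hilbert space, $\mathcal H_{\rm eq}\subseteq\mathcal H$ any subspace with orthogonal projection $P_{\rm eq}$, $P_{\rm neq}=I-P_{\rm eq}$, and for $\varepsilon\in\mathbb R$ let $$\mathrm{MATE}_\varepsilon=\{\psi\in\mathcal H:\ \|\psi\|=1,\ \|P_{\rm eq}\psi\|^2\ge 1-\varepsilon\}.$$ Let $H_0$ be a self-adjoint operator on $\mathcal H$ with eigenspaces $\mathcal H_e$ and $D_e=\dim\mathcal H_e$. Let $$\varepsilon_*=\inf\{\eta>0:\ \text{every normalized eigenvector of } H_0 \text{ lies in } \mathrm{MATE}_\eta\},$$ let $\phi_*$ be a normalized eigenvector of $H_0$ with $\|P_{\rm neq}\phi_*\|^2=\varepsilon_*$, and let $e_*$ be its eigenvalue. Proposition. For every $0<\delta<1$ there exists $D_0(\delta)>0$, depending only on $\delta$, such that for all $\mathcal H,\mathcal H_{\rm eq},H_0,e_*$ as above with $D_{e_*}\ge D_0(\delta)$, the following holds. Let $(\chi_k)_{k=1}^{D_{e_*}}$ be a random orthonormal basis of $\mathcal H_{e_*}$ with uniform (Haar) distribution. Then for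 every $\varepsilon'$ with $$0<\varepsilon'\le\varepsilon_*\,\frac{\log(\delta D_{e_*})}{5D_{e_*}}$$ (with $\log$ the natural logarithm), $$\mathbb P\bigl(\exists k\in\{1,\dots,D_{e_*}\}:\ \chi_k\notin\mathrm{MATE}_{\varepsilon'}\bigr)\ \ge\ 1-\delta .$$ -/

import Mathlib

open MeasureTheory ProbabilityTheory

noncomputable section

namespace RandomEigenbasis

section Haar

instance unitaryCompact (n : ℕ) : CompactSpace (Matrix.unitaryGroup (Fin n) ℂ) := by
  have hK : IsCompact (Set.univ.pi fun _ : Fin n => Set.univ.pi fun _ : Fin n =>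
      Metric.closedBall (0 : ℂ) 1) :=
    isCompact_univ_pi fun _ => isCompact_univ_pi fun _ => isCompact_closedBall 0 1
  have hcl : IsClosed ((Matrix.unitaryGroup (Fin n) ℂ : Set (Matrix (Fin n) (Fin n) ℂ))) :=
    isClosed_unitary
  refine isCompact_iff_compactSpace.mp (hK.of_isClosed_subset hcl ?_)
  intro U hU i _ j _
  simpa using entry_norm_bound_of_unitary hU i j

/-- The unitary group `U(n)` carries its Borel σ-algebra. -/
instance unitaryMeasurable (n : ℕ) : MeasurableSpace (Matrix.unitaryGroup (Fin n) ℂ) :=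
  borel _

instance unitaryBorel (n : ℕ) : BorelSpace (Matrix.unitaryGroup (Fin n) ℂ) := ⟨rfl⟩

/-- The normalized Haar measure on the compact group `U(n)`. -/
def haarUnitary (n : ℕ) : Measure (Matrix.unitaryGroup (Fin n) ℂ) :=
  Measure.haarMeasure ⊤

instance haarUnitary_prob (n : ℕ) : IsProbabilityMeasure (haarUnitary n) :=
  ⟨by simpa [haarUnitary] using
    Measure.haarMeasure_self (K₀ := (⊤ : TopologicalSpace.PositiveCompacts
      (Matrix.unitaryGroup (Fin n) ℂ)))⟩

variable (V : Type*) [NormedAddCommGroup V] [InnerProductSpace ℂ V] [FiniteDimensional ℂ V]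

/-- The family `χ_k = ∑ j, U j k • b j`, the image under the unitary matrix `U` of a fixed
orthonormal basis `b` of `V`. -/
def rotatedBasis (U : Matrix.unitaryGroup (Fin (Module.finrank ℂ V)) ℂ) :
    Fin (Module.finrank ℂ V) → V :=
  fun k => ∑ j, (U : Matrix _ _ ℂ) j k • stdOrthonormalBasis ℂ V j

/-- The uniform (Haar) distribution on the orthonormal bases of `V`: the law of the image of a
fixed orthonormal basis under a Haar-distributed unitary. By invariance of Haar measure it does
not depend on the fixed basis. -/
def haarONB [MeasurableSpace V] : Measure (Fin (Module.finrank ℂ V) → V) :=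
  (haarUnitary (Module.finrank ℂ V)).map (rotatedBasis V)

lemma measurable_rotatedBasis [MeasurableSpace V] [BorelSpace V] :
    Measurable (rotatedBasis V) := by
  refine measurable_pi_lambda _ fun k => Continuous.measurable ?_
  unfold rotatedBasis
  refine continuous_finsetSum _ fun j _ => Continuous.smul ?_ continuous_const
  exact (continuous_subtype_val.matrix_elem j k)

instance haarONB_prob [MeasurableSpace V] [BorelSpace V] : IsProbabilityMeasure (haarONB V) :=
  Measure.isProbabilityMeasure_map (measurable_rotatedBasis V).aemeasurable

end Haar

section MATE

variable {H : Type*} [NormedAddCommGroup H] [InnerProductSpace ℂ H] [FiniteDimensional ℂ H]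

/-- `MATE_ε`: the unit vectors `ψ` with `‖P_eq ψ‖² ≥ 1 - ε`, where `P_eq` is the orthogonal
projection onto `Heq`. -/
def MATE (Heq : Submodule ℂ H) (ε : ℝ) : Set H :=
  {ψ | ‖ψ‖ = 1 ∧ 1 - ε ≤ ‖Heq.starProjection ψ‖ ^ 2}

/-- `ε_*`: the infimum of the `δ > 0` such that every normalized eigenvector of `H₀` lies in
`MATE_δ`. -/
def epsStar (Heq : Submodule ℂ H) (H₀ : Module.End ℂ H) : ℝ :=
  sInf {δ : ℝ | 0 < δ ∧ ∀ e ∈ spectrum ℂ H₀, ∀ φ ∈ H₀.eigenspace e, ‖φ‖ = 1 → φ ∈ MATE Heq δ}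

/-- `e` is a worst eigenvalue: some normalized eigenvector `φ` of `H₀` with eigenvalue `e` has
`‖P_neq φ‖² = ε_*`, where `P_neq = I - P_eq`. -/
def IsWorstEigenvalue (Heq : Submodule ℂ H) (H₀ : Module.End ℂ H) (e : ℂ) : Prop :=
  ∃ φ ∈ H₀.eigenspace e, ‖φ‖ = 1 ∧ ‖φ - Heq.starProjection φ‖ ^ 2 = epsStar Heq H₀

end MATE

end RandomEigenbasis

end

/-! Let `T = I - P_eq`. The worst eigenvector `φ` maximizes `‖T x‖²` over unit vectors of its
eigenspace, so `T` sends vectors orthogonal to `φ` to vectors orthogonal to `T φ`. Hence `‖T χ‖² ≥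
ε_* |⟨φ, χ⟩|²` for every `χ` there, and it suffices that some `χ_k` has squared overlap above `t =
log (δ D) / (5 D)` (`notMem_MATE_of_lt`).

The overlaps `⟨φ, χ_k⟩` are the coordinates of a Haar-rotated unit vector, that is, of a normalized
complex Gaussian `z` (`haarUnitary_flat_mul_le`). The `|z_k|²` are i.i.d. exponential of mean 1. If
all overlaps are at most `t`, either `‖z‖² ≥ 2D`, of probability at most `(2/e)^D`, or every `|z_k|²
≤ 2Dt`, of probability `(1 - e^(-2Dt))^D ≤ exp (-(δD)^(3/5))`. Both bounds tend to 0. -/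

noncomputable section

namespace RandomEigenbasis

/-! ### Gaussian weight of the flat vectors -/

section Gaussian

/-- The squared Euclidean norm on `ℂⁿ`. -/
def normSqSum {n : ℕ} (z : Fin n → ℂ) : ℝ := ∑ i, ‖z i‖ ^ 2

lemma measurable_normSqSum {n : ℕ} : Measurable (normSqSum (n := n)) := by
  unfold normSqSum; fun_prop

/-- The unnormalized Gaussian measure with density `exp (-‖z‖²)` on `ℂⁿ`. -/
def gaussianWeight (n : ℕ) : Measure (Fin n → ℂ) :=
  volume.withDensity fun z => ENNReal.ofReal (Real.exp (-normSqSum z))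

lemma integrable_exp_neg_mul_norm_sq {b : ℝ} (hb : 0 < b) :
    Integrable fun z : ℂ => Real.exp (-b * ‖z‖ ^ 2) := by
  refine MeasureTheory.Integrable.of_integral_ne_zero ?_
  rw [GaussianFourier.integral_rexp_neg_mul_sq_norm hb]
  positivity

lemma integral_exp_neg_mul_norm_sq {b : ℝ} (hb : 0 < b) :
    ∫ z : ℂ, Real.exp (-b * ‖z‖ ^ 2) = Real.pi / b := by
  rw [GaussianFourier.integral_rexp_neg_mul_sq_norm hb]
  simp

/-- Polar coordinates: up to the factor `π`, `‖z‖²` is exponentially distributed. -/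
lemma integral_indicator_exp_neg_norm_sq {s : ℝ} (hs : 0 ≤ s) :
    ∫ z : ℂ, {z : ℂ | ‖z‖ ^ 2 ≤ s}.indicator (fun z => Real.exp (-‖z‖ ^ 2)) z =
      Real.pi * (1 - Real.exp (-s)) := by
  have h := integral_fun_norm_addHaar (E := ℂ) volume
    ((Set.Iic (Real.sqrt s)).indicator fun y => Real.exp (-y ^ 2))
  have h1 : ∀ z : ℂ, {z : ℂ | ‖z‖ ^ 2 ≤ s}.indicator (fun z => Real.exp (-‖z‖ ^ 2)) z =
      (Set.Iic (Real.sqrt s)).indicator (fun y => Real.exp (-y ^ 2)) ‖z‖ := by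
    intro z
    simp only [Set.indicator_apply, Set.mem_ofPred_eq, Set.mem_Iic,
      Real.le_sqrt (norm_nonneg z) hs]
  simp_rw [h1, h]
  have h2 : ∫ y in Set.Ioi (0 : ℝ), y ^ (Module.finrank ℝ ℂ - 1) •
      (Set.Iic (Real.sqrt s)).indicator (fun y => Real.exp (-y ^ 2)) y =
      ∫ y in (0 : ℝ)..Real.sqrt s, y * Real.exp (-y ^ 2) := by
    rw [intervalIntegral.integral_of_le (Real.sqrt_nonneg s), ← Set.Ioi_inter_Iic,
      ← setIntegral_indicator measurableSet_Iic]
    refine integral_congr_ae (Filter.Eventually.of_forall fun y => ?_)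
    by_cases hy : y ∈ Set.Iic (Real.sqrt s) <;> simp [hy, Complex.finrank_real_complex]
  have h3 : ∫ y in (0 : ℝ)..Real.sqrt s, y * Real.exp (-y ^ 2) = (1 - Real.exp (-s)) / 2 := by
    have hd : ∀ y ∈ Set.uIcc 0 (Real.sqrt s),
        HasDerivAt (fun y : ℝ => -Real.exp (-y ^ 2) / 2) (y * Real.exp (-y ^ 2)) y := by
      intro y _
      have := ((((hasDerivAt_pow 2 y).neg).exp).neg).div_const 2
      refine this.congr_deriv ?_
      simp; ring
    rw [intervalIntegral.integral_eq_sub_of_hasDerivAt hd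
      (Continuous.intervalIntegrable (by fun_prop) _ _), Real.sq_sqrt hs]
    simp; ring
  have h4 : volume.real (Metric.ball (0 : ℂ) 1) = Real.pi := by
    simp [measureReal_def, Complex.volume_ball]
  rw [h2, h3, h4, Complex.finrank_real_complex]
  simp; ring

lemma gaussianWeight_univ (n : ℕ) :
    gaussianWeight n Set.univ = ENNReal.ofReal (Real.pi ^ n) := by
  have h1 : ∀ z : Fin n → ℂ, Real.exp (-normSqSum z) = ∏ i, Real.exp (-1 * ‖z i‖ ^ 2) := by
    intro z
    rw [← Real.exp_sum, normSqSum, ← Finset.mul_sum, neg_one_mul]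
  have hi : Integrable fun z : Fin n → ℂ => Real.exp (-normSqSum z) := by
    simp_rw [h1]
    exact Integrable.fintype_prod fun _ => integrable_exp_neg_mul_norm_sq one_pos
  rw [gaussianWeight, withDensity_apply _ MeasurableSet.univ, setLIntegral_univ,
    ← ofReal_integral_eq_lintegral_ofReal hi
      (Filter.Eventually.of_forall fun _ => (Real.exp_pos _).le)]
  simp_rw [h1]
  rw [integral_fintype_prod_volume_eq_pow (fun z : ℂ => Real.exp (-1 * ‖z‖ ^ 2)),
    integral_exp_neg_mul_norm_sq one_pos]
  simp

instance (n : ℕ) : IsFiniteMeasure (gaussianWeight n) :=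
  ⟨by rw [gaussianWeight_univ]; exact ENNReal.ofReal_lt_top⟩

/-- The vectors of `ℂⁿ` all of whose coordinates carry at most a fraction `t` of the squared
norm. -/
def flatVectors (n : ℕ) (t : ℝ) : Set (Fin n → ℂ) := {z | ∀ k, ‖z k‖ ^ 2 ≤ t * normSqSum z}

lemma measurableSet_flatVectors (n : ℕ) (t : ℝ) : MeasurableSet (flatVectors n t) := by
  unfold flatVectors
  simp only [Set.ofPred_forall]
  exact MeasurableSet.iInter fun k =>
    measurableSet_le (by fun_prop) (measurable_normSqSum.const_mul t)

lemma gaussianWeight_flatVectors_le (n : ℕ) {t : ℝ} (ht : 0 ≤ t) :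
    gaussianWeight n (flatVectors n t) ≤ ENNReal.ofReal
      (Real.pi ^ n * ((2 * Real.exp (-1)) ^ n + (1 - Real.exp (-(2 * n * t))) ^ n)) := by
  set f : ℂ → ℝ := {z : ℂ | ‖z‖ ^ 2 ≤ 2 * n * t}.indicator (fun z => Real.exp (-‖z‖ ^ 2))
  have hf0 : ∀ z, 0 ≤ f z := Set.indicator_nonneg fun _ _ => (Real.exp_pos _).le
  have hfi : Integrable f := by
    refine Integrable.indicator ?_ (measurableSet_le (by fun_prop) measurable_const)
    simpa using integrable_exp_neg_mul_norm_sq one_pos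
  have hg := integrable_exp_neg_mul_norm_sq (b := 1 / 2) (by norm_num)
  have hgi : Integrable fun z : Fin n → ℂ =>
      Real.exp (-n) * ∏ i, Real.exp (-(1 / 2) * ‖z i‖ ^ 2) :=
    (Integrable.fintype_prod fun _ => hg).const_mul _
  have hfi' : Integrable fun z : Fin n → ℂ => ∏ i, f (z i) := Integrable.fintype_prod fun _ => hfi
  have hg' : ∀ z : Fin n → ℂ, Real.exp (-n) * ∏ i, Real.exp (-(1 / 2) * ‖z i‖ ^ 2) =
      Real.exp (-n - normSqSum z / 2) := by
    intro z
    rw [← Real.exp_sum, ← Finset.mul_sum, ← Real.exp_add, normSqSum]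
    congr 1; ring
  have key : ∀ z ∈ flatVectors n t, Real.exp (-normSqSum z) ≤
      Real.exp (-n) * ∏ i, Real.exp (-(1 / 2) * ‖z i‖ ^ 2) + ∏ i, f (z i) := by
    intro z hz
    -- For small norm, flatness bounds each coordinate by the fixed threshold `2nt`, which decouples
    -- the coordinates. For large norm, half of the exponent is traded for `e^(-n)` (a Chernoff
    -- bound).
    rcases le_total (normSqSum z) (2 * n) with h | h
    · have : ∏ i, f (z i) = Real.exp (-normSqSum z) := by
        have h1 : ∀ i, f (z i) = Real.exp (-‖z i‖ ^ 2) := by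
          intro i
          refine Set.indicator_of_mem (s := {z : ℂ | ‖z‖ ^ 2 ≤ 2 * n * t}) ?_ _
          rw [Set.mem_ofPred_eq]
          nlinarith [hz i, mul_le_mul_of_nonneg_left h ht]
        simp_rw [h1]
        rw [← Real.exp_sum, normSqSum, Finset.sum_neg_distrib]
      rw [this, hg']
      exact le_add_of_nonneg_left (Real.exp_pos _).le
    · rw [hg']
      have := Finset.prod_nonneg (s := Finset.univ) fun i _ => hf0 (z i)
      have : Real.exp (-normSqSum z) ≤ Real.exp (-n - normSqSum z / 2) :=
        Real.exp_le_exp.2 (by linarith)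
      linarith
  have hint : ∫ z : Fin n → ℂ, (Real.exp (-n) * ∏ i, Real.exp (-(1 / 2) * ‖z i‖ ^ 2) +
      ∏ i, f (z i)) =
      Real.pi ^ n * ((2 * Real.exp (-1)) ^ n + (1 - Real.exp (-(2 * n * t))) ^ n) := by
    rw [integral_add hgi hfi', integral_const_mul,
      integral_fintype_prod_volume_eq_pow (fun z : ℂ => Real.exp (-(1 / 2) * ‖z‖ ^ 2)),
      integral_exp_neg_mul_norm_sq (by norm_num), integral_fintype_prod_volume_eq_pow f,
      integral_indicator_exp_neg_norm_sq (by positivity), mul_pow, mul_pow, ← Real.exp_nat_mul,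
      div_pow, div_pow, Fintype.card_fin]
    simp only [one_pow, mul_neg, mul_one, one_div, div_inv_eq_mul]
    ring
  rw [gaussianWeight, withDensity_apply _ (measurableSet_flatVectors n t), ← hint,
    ofReal_integral_eq_lintegral_ofReal (f := fun z : Fin n → ℂ => Real.exp (-n) *
      ∏ i, Real.exp (-(1 / 2) * ‖z i‖ ^ 2) + ∏ i, f (z i)) (hgi.add hfi')]
  · refine (setLIntegral_mono' (measurableSet_flatVectors n t) fun z hz =>
      ENNReal.ofReal_le_ofReal (key z hz)).trans (setLIntegral_le_lintegral _ _)
  · refine Filter.Eventually.of_forall fun z => ?_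
    have := Finset.prod_nonneg (s := Finset.univ) fun i _ => hf0 (z i)
    show 0 ≤ _ + _
    positivity

end Gaussian

/-! ### From Haar measure to Gaussian weight -/

section Unitary

open Matrix

lemma normSqSum_eq_dotProduct {n : ℕ} (z : Fin n → ℂ) :
    (normSqSum z : ℂ) = z ⬝ᵥ star z := by
  simp [normSqSum, dotProduct, Complex.mul_conj, Complex.normSq_eq_norm_sq]

lemma normSqSum_vecMul {n : ℕ} (z : Fin n → ℂ) (U : Matrix.unitaryGroup (Fin n) ℂ) :
    normSqSum (z ᵥ* (U : Matrix (Fin n) (Fin n) ℂ)) = normSqSum z := by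
  have h : (U : Matrix (Fin n) (Fin n) ℂ) * (U : Matrix (Fin n) (Fin n) ℂ)ᴴ = 1 :=
    Matrix.mem_unitaryGroup_iff.1 U.2
  rw [← Complex.ofReal_inj, normSqSum_eq_dotProduct, normSqSum_eq_dotProduct, star_vecMul,
    dotProduct_mulVec, vecMul_vecMul, h, vecMul_one]

lemma measurePreserving_vecMul {n : ℕ} (U : Matrix.unitaryGroup (Fin n) ℂ) :
    MeasurePreserving (fun z : Fin n → ℂ => z ᵥ* (U : Matrix (Fin n) (Fin n) ℂ)) := by
  refine ⟨by fun_prop, ?_⟩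
  have hdet : ‖(U : Matrix (Fin n) (Fin n) ℂ).det‖ = 1 :=
    CStarRing.norm_of_mem_unitary (Matrix.det_of_mem_unitary U.2)
  have h1 : LinearMap.det ((Matrix.vecMulLinear (U : Matrix (Fin n) (Fin n) ℂ)).restrictScalars ℝ)
      = 1 := by
    rw [LinearMap.det_restrictScalars, Algebra.norm_complex_apply, Complex.normSq_eq_norm_sq]
    have : Matrix.vecMulLinear (U : Matrix (Fin n) (Fin n) ℂ) =
        Matrix.toLin' (U : Matrix (Fin n) (Fin n) ℂ)ᵀ := by
      ext; simp
    rw [this, LinearMap.det_toLin', Matrix.det_transpose, hdet, one_pow]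
  have := Measure.map_linearMap_addHaar_eq_smul_addHaar (volume : Measure (Fin n → ℂ))
    (f := (Matrix.vecMulLinear (U : Matrix (Fin n) (Fin n) ℂ)).restrictScalars ℝ)
    (by rw [h1]; exact one_ne_zero)
  rw [h1] at this
  simp only [inv_one, abs_one, ENNReal.ofReal_one, one_smul] at this
  exact this

lemma gaussianWeight_preimage_vecMul {n : ℕ} (U : Matrix.unitaryGroup (Fin n) ℂ)
    {A : Set (Fin n → ℂ)} (hA : MeasurableSet A) :
    gaussianWeight n ((fun z => z ᵥ* (U : Matrix (Fin n) (Fin n) ℂ)) ⁻¹' A) = gaussianWeight n A := by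
  have hU := measurePreserving_vecMul U
  rw [gaussianWeight, withDensity_apply _ hA, withDensity_apply _ (hU.measurable hA),
    ← hU.setLIntegral_comp_preimage (f := fun z => ENNReal.ofReal (Real.exp (-normSqSum z))) hA
      (measurable_normSqSum.neg.exp.ennreal_ofReal)]
  simp_rw [normSqSum_vecMul]

lemma measurable_vecMul_unitary {n : ℕ} :
    Measurable fun p : (Fin n → ℂ) × Matrix.unitaryGroup (Fin n) ℂ =>
      p.1 ᵥ* (p.2 : Matrix (Fin n) (Fin n) ℂ) := by
  refine measurable_pi_lambda _ fun k => ?_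
  simp only [vecMul, dotProduct]
  refine Finset.measurable_sum _ fun i _ => Measurable.mul (by fun_prop) ?_
  have : Continuous fun U : Matrix.unitaryGroup (Fin n) ℂ => (U : Matrix (Fin n) (Fin n) ℂ) i k :=
    continuous_subtype_val.matrix_elem i k
  exact this.measurable.comp measurable_snd

lemma haarUnitary_preimage_vecMul {n : ℕ} (w : Fin n → ℂ) (W : Matrix.unitaryGroup (Fin n) ℂ)
    (A : Set (Fin n → ℂ)) :
    haarUnitary n {U | (w ᵥ* (W : Matrix (Fin n) (Fin n) ℂ)) ᵥ* (U : Matrix (Fin n) (Fin n) ℂ) ∈ A} =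
      haarUnitary n {U | w ᵥ* (U : Matrix (Fin n) (Fin n) ℂ) ∈ A} := by
  have : (haarUnitary n).IsMulLeftInvariant := by unfold haarUnitary; infer_instance
  rw [← measure_preimage_mul (haarUnitary n) W {U | w ᵥ* (U : Matrix (Fin n) (Fin n) ℂ) ∈ A}]
  simp [vecMul_vecMul, Set.preimage]

/-- Transitivity on the unit sphere: with left invariance, the law of `w ᵥ* U` is the same for every
unit `w`. -/
lemma exists_unitary_row {n : ℕ} (i : Fin n) {w : Fin n → ℂ} (hw : normSqSum w = 1) :
    ∃ W : Matrix.unitaryGroup (Fin n) ℂ, Pi.single i 1 ᵥ* (W : Matrix (Fin n) (Fin n) ℂ) = w := by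
  have hn : ‖(WithLp.toLp 2 w : EuclideanSpace ℂ (Fin n))‖ = 1 := by
    rw [EuclideanSpace.norm_eq]
    simpa [normSqSum] using hw
  obtain ⟨b, hb⟩ := Orthonormal.exists_orthonormalBasis_extension_of_card_eq (𝕜 := ℂ)
    (E := EuclideanSpace ℂ (Fin n)) (ι := Fin n) (by simp)
    (v := fun _ => WithLp.toLp 2 w) (s := {i})
    (by
      rw [orthonormal_iff_ite]
      rintro ⟨a, ha⟩ ⟨c, hc⟩
      obtain rfl : a = i := ha
      obtain rfl : c = a := hc
      simp [inner_self_eq_norm_sq_to_K, hn])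
  have hU := OrthonormalBasis.toMatrix_orthonormalBasis_mem_unitary
    (EuclideanSpace.basisFun (Fin n) ℂ) b
  refine ⟨⟨_, Matrix.transpose_mem_unitaryGroup_iff.2 hU⟩, ?_⟩
  ext k
  simp [Module.Basis.toMatrix_apply, hb i rfl]

lemma smul_vecMul_mem_flatVectors_iff {n : ℕ} {t c : ℝ} (hc : 0 < c) (z : Fin n → ℂ) :
    ((c : ℂ) • z) ∈ flatVectors n t ↔ z ∈ flatVectors n t := by
  have h : normSqSum ((c : ℂ) • z) = c ^ 2 * normSqSum z := by
    simp [normSqSum, mul_pow, Finset.mul_sum]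
  simp only [flatVectors, Set.mem_ofPred_eq, h]
  refine forall_congr' fun k => ?_
  simp only [Pi.smul_apply, mul_pow, Complex.norm_real, Real.norm_eq_abs, sq_abs,
    smul_eq_mul, norm_mul]
  rw [mul_left_comm, mul_le_mul_iff_right₀ (by positivity)]

/-- A Haar-random rotation of a unit vector is flat with probability at most the normalized Gaussian
weight of the flat vectors. -/
lemma haarUnitary_flat_mul_le {n : ℕ} (t : ℝ) {w : Fin n → ℂ} (hw : normSqSum w = 1) :
    haarUnitary n {U | w ᵥ* (U : Matrix (Fin n) (Fin n) ℂ) ∈ flatVectors n t} * gaussianWeight n Set.univ ≤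
      gaussianWeight n (flatVectors n t) := by
  obtain ⟨i⟩ : Nonempty (Fin n) := by
    by_contra h
    rw [not_nonempty_iff] at h
    simp [normSqSum] at hw
  have hA := measurableSet_flatVectors n t
  -- Equality holds for `z ≠ 0`, flatness being scale invariant; the zero vector is always flat, so
  -- the inequality covers it too.
  have hconst : ∀ z : Fin n → ℂ,
      haarUnitary n {U | w ᵥ* (U : Matrix (Fin n) (Fin n) ℂ) ∈ flatVectors n t} ≤
        haarUnitary n {U | z ᵥ* (U : Matrix (Fin n) (Fin n) ℂ) ∈ flatVectors n t} := by
    intro z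
    have hz0 : 0 ≤ normSqSum z := Finset.sum_nonneg fun _ _ => sq_nonneg _
    rcases hz0.eq_or_lt with h | h
    · have hz : z = 0 := by
        ext k
        have := (Finset.sum_eq_zero_iff_of_nonneg fun _ _ => sq_nonneg _).1 h.symm k
          (Finset.mem_univ k)
        simpa using this
      subst hz
      have : {U : Matrix.unitaryGroup (Fin n) ℂ |
          (0 : Fin n → ℂ) ᵥ* (U : Matrix (Fin n) (Fin n) ℂ) ∈ flatVectors n t} = Set.univ := by
        ext U; simp [flatVectors, normSqSum]
      rw [this]
      exact measure_mono (Set.subset_univ _)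
    · set c := (Real.sqrt (normSqSum z))⁻¹
      have hc : 0 < c := inv_pos.2 (Real.sqrt_pos.2 h)
      have hcz : normSqSum ((c : ℂ) • z) = 1 := by
        have : normSqSum ((c : ℂ) • z) = c ^ 2 * normSqSum z := by
          simp [normSqSum, mul_pow, Finset.mul_sum]
        rw [this, inv_pow, Real.sq_sqrt hz0, inv_mul_cancel₀ h.ne']
      obtain ⟨W, hW⟩ := exists_unitary_row i hw
      obtain ⟨W', hW'⟩ := exists_unitary_row i hcz
      have e1 := haarUnitary_preimage_vecMul (Pi.single i 1) W (flatVectors n t)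
      have e2 := haarUnitary_preimage_vecMul (Pi.single i 1) W' (flatVectors n t)
      rw [hW] at e1
      rw [hW'] at e2
      simp only [smul_vecMul, smul_vecMul_mem_flatVectors_iff hc] at e2
      rw [e1, e2]
  have hm := measurable_vecMul_unitary (n := n) hA
  -- Average over Gaussian `z` and apply Fubini; for fixed `U`, unitary invariance of the weight
  -- removes `U`.
  calc _ = ∫⁻ _, haarUnitary n {U | w ᵥ* (U : Matrix (Fin n) (Fin n) ℂ) ∈ flatVectors n t}
          ∂gaussianWeight n := by rw [lintegral_const]
    _ ≤ ∫⁻ z, haarUnitary n {U | z ᵥ* (U : Matrix (Fin n) (Fin n) ℂ) ∈ flatVectors n t}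
          ∂gaussianWeight n := lintegral_mono hconst
    _ = ((gaussianWeight n).prod (haarUnitary n)) _ := (Measure.prod_apply hm).symm
    _ = ∫⁻ U, gaussianWeight n ((fun z => z ᵥ* (U : Matrix (Fin n) (Fin n) ℂ)) ⁻¹' flatVectors n t)
          ∂haarUnitary n := Measure.prod_apply_symm hm
    _ = gaussianWeight n (flatVectors n t) := by
      simp_rw [gaussianWeight_preimage_vecMul _ hA]
      simp

lemma haarUnitary_flat_le {n : ℕ} {t : ℝ} (ht : 0 ≤ t) {w : Fin n → ℂ} (hw : normSqSum w = 1) :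
    (haarUnitary n).real {U | w ᵥ* (U : Matrix (Fin n) (Fin n) ℂ) ∈ flatVectors n t} ≤
      (2 * Real.exp (-1)) ^ n + (1 - Real.exp (-(2 * n * t))) ^ n := by
  have h := (haarUnitary_flat_mul_le t hw).trans (gaussianWeight_flatVectors_le n ht)
  have hpi : 0 < Real.pi ^ n := by positivity
  have h1 : Real.exp (-(2 * n * t)) ≤ 1 := Real.exp_le_one_iff.2 (by simpa using by positivity)
  have h2 : 0 ≤ 1 - Real.exp (-(2 * n * t)) := sub_nonneg.2 h1
  rw [gaussianWeight_univ, ← ofReal_measureReal, ← ENNReal.ofReal_mul measureReal_nonneg,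
    ENNReal.ofReal_le_ofReal_iff (by positivity), mul_comm] at h
  exact le_of_mul_le_mul_left h hpi

end Unitary

/-! ### Choice of the dimension threshold -/

section Asymptotics

lemma exists_forall_flat_bound_le {δ : ℝ} (hδ0 : 0 < δ) (hδ1 : δ < 1) :
    ∃ D₀ : ℝ, 0 < D₀ ∧ ∀ n : ℕ, D₀ ≤ n → 1 ≤ δ * n ∧
      (2 * Real.exp (-1)) ^ n + (1 - Real.exp (-(2 * n * (Real.log (δ * n) / (5 * n))))) ^ n ≤
        δ := by
  have hx : Filter.Tendsto (fun n : ℕ => δ * (n : ℝ)) Filter.atTop Filter.atTop :=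
    tendsto_natCast_atTop_atTop.const_mul_atTop hδ0
  have h1 : Filter.Tendsto (fun n : ℕ => (2 * Real.exp (-1)) ^ n) Filter.atTop (nhds 0) := by
    refine tendsto_pow_atTop_nhds_zero_of_lt_one (by positivity) ?_
    rw [Real.exp_neg, ← div_eq_mul_inv, div_lt_one (Real.exp_pos _)]
    exact lt_trans (by norm_num) Real.exp_one_gt_d9
  have h2 : Filter.Tendsto (fun n : ℕ => Real.exp (-(δ * (n : ℝ)) ^ (3 / 5 : ℝ))) Filter.atTop
      (nhds 0) :=
    Real.tendsto_exp_neg_atTop_nhds_zero.comp ((tendsto_rpow_atTop (by norm_num)).comp hx)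
  have h3 := (h1.add h2).eventually (ge_mem_nhds (by simpa using hδ0 : (0 : ℝ) + 0 < δ))
  obtain ⟨N, hN⟩ := Filter.eventually_atTop.1 (h3.and (hx.eventually_ge_atTop 1))
  refine ⟨N + 1, by positivity, fun n hn => ?_⟩
  obtain ⟨hs, hn1⟩ := hN n (by exact_mod_cast (le_trans (by linarith) hn : (N : ℝ) ≤ n))
  refine ⟨hn1, le_trans (add_le_add_right ?_ _) hs⟩
  have hn0 : (0 : ℝ) < n := lt_of_lt_of_le (by positivity) hn
  have hlog : 0 ≤ Real.log (δ * n) := Real.log_nonneg hn1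
  have hpos : 0 < δ * (n : ℝ) := by positivity
  have e1 : 2 * (n : ℝ) * (Real.log (δ * n) / (5 * n)) = Real.log (δ * n) * (2 / 5) := by
    field_simp
  have e2 : Real.exp (-(2 * n * (Real.log (δ * n) / (5 * n)))) = (δ * n) ^ (-(2 / 5) : ℝ) := by
    rw [e1, Real.rpow_def_of_pos hpos, mul_neg]
  have e3 : (δ * (n : ℝ)) ^ (3 / 5 : ℝ) ≤ n * (δ * n) ^ (-(2 / 5) : ℝ) := by
    have : (δ * (n : ℝ)) ^ (3 / 5 : ℝ) = (δ * n) * (δ * n) ^ (-(2 / 5) : ℝ) := by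
      rw [← Real.rpow_one_add' hpos.le (by norm_num)]
      norm_num
    rw [this]
    -- Here `δ < 1` enters, through `δ n ≤ n`.
    exact mul_le_mul_of_nonneg_right (by nlinarith) (Real.rpow_nonneg hpos.le _)
  have e4 : (δ * (n : ℝ)) ^ (-(2 / 5) : ℝ) ≤ 1 :=
    Real.rpow_le_one_of_one_le_of_nonpos hn1 (by norm_num)
  rw [e2]
  calc (1 - (δ * (n : ℝ)) ^ (-(2 / 5) : ℝ)) ^ n
      ≤ Real.exp (-(δ * (n : ℝ)) ^ (-(2 / 5) : ℝ)) ^ n :=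
        pow_le_pow_left₀ (by linarith) (Real.one_sub_le_exp_neg _) n
    _ = Real.exp (-(n * (δ * (n : ℝ)) ^ (-(2 / 5) : ℝ))) := by
        rw [← Real.exp_nat_mul, mul_neg]
    _ ≤ _ := Real.exp_le_exp.2 (neg_le_neg e3)

end Asymptotics

/-! ### Orthogonality at a maximizer -/

section Maximizer

variable {H : Type*} [NormedAddCommGroup H] [InnerProductSpace ℂ H]

/-- If `φ` maximizes `‖T x‖²` over the unit vectors `x` of `K`, then `T` maps the vectors of `K`
orthogonal to `φ` to vectors orthogonal to `T φ`. -/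
lemma inner_map_eq_zero_of_maximizer (T : H →ₗ[ℂ] H) {K : Submodule ℂ H} {m : ℝ}
    (hT : ∀ x ∈ K, ‖T x‖ ^ 2 ≤ m * ‖x‖ ^ 2) {φ ψ : H} (hφ : φ ∈ K) (hφ1 : ‖φ‖ = 1)
    (hφm : ‖T φ‖ ^ 2 = m) (hψ : ψ ∈ K) (hφψ : inner ℂ φ ψ = 0) :
    inner ℂ (T φ) (T ψ) = 0 := by
  set a : ℂ := inner ℂ (T φ) (T ψ)
  have hm : 0 ≤ m := hφm ▸ sq_nonneg _
  set C : ℝ := m * ‖ψ‖ ^ 2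
  have hC : 0 ≤ C := by positivity
  set τ : ℝ := (C + 1)⁻¹
  have hτ : 0 < τ := by positivity
  have hτC : τ * C ≤ 1 := by
    have : τ * (C + 1) = 1 := inv_mul_cancel₀ (by positivity)
    nlinarith
  -- Perturbing `φ` by `s • ψ`, with phase aligned to `a`, gains `2τ‖a‖²` at first order, while the
  -- bound `m‖x‖²` grows only by `τ²‖a‖²C ≤ τ‖a‖²`; so `a = 0`.
  set s : ℂ := (τ : ℂ) * star a
  have hs : ‖s‖ ^ 2 = τ ^ 2 * ‖a‖ ^ 2 := by
    simp [s, mul_pow]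
  have h1 : ‖φ + s • ψ‖ ^ 2 = 1 + ‖s‖ ^ 2 * ‖ψ‖ ^ 2 := by
    rw [@norm_add_sq ℂ, inner_smul_right, hφψ, norm_smul, hφ1]
    simp [mul_pow]
  have h2 : ‖T (φ + s • ψ)‖ ^ 2 = m + 2 * (τ * ‖a‖ ^ 2) + ‖s‖ ^ 2 * ‖T ψ‖ ^ 2 := by
    rw [map_add, map_smul, @norm_add_sq ℂ, inner_smul_right, norm_smul, hφm, mul_pow]
    have : s * a = ((τ * ‖a‖ ^ 2 : ℝ) : ℂ) := by
      have := Complex.conj_mul' a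
      simp only [s, mul_assoc, Complex.star_def, this]
      push_cast; rfl
    change m + 2 * RCLike.re (s * a) + _ = _
    rw [this]
    simp only [RCLike.re_to_complex, Complex.ofReal_re]
  have h3 := hT _ (K.add_mem hφ (K.smul_mem s hψ))
  rw [h1, h2, hs] at h3
  have h4 : 0 ≤ τ ^ 2 * ‖a‖ ^ 2 * ‖T ψ‖ ^ 2 := by positivity
  have h5 : 2 * (τ * ‖a‖ ^ 2) ≤ (τ * ‖a‖ ^ 2) * (τ * C) := by
    simp only [C]; nlinarith
  have h6 : (τ * ‖a‖ ^ 2) * (τ * C) ≤ τ * ‖a‖ ^ 2 :=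
    mul_le_of_le_one_right (by positivity) hτC
  have h7 : τ * ‖a‖ ^ 2 ≤ 0 := by linarith
  have h8 : ‖a‖ ^ 2 ≤ 0 := nonpos_of_mul_nonpos_right h7 hτ
  simpa using le_antisymm h8 (sq_nonneg _)

/-- Split `x` into its component along `φ` and the rest: the images are orthogonal, so Pythagoras
applies. -/
lemma mul_norm_inner_sq_le_of_maximizer (T : H →ₗ[ℂ] H) {K : Submodule ℂ H} {m : ℝ}
    (hT : ∀ x ∈ K, ‖T x‖ ^ 2 ≤ m * ‖x‖ ^ 2) {φ x : H} (hφ : φ ∈ K) (hφ1 : ‖φ‖ = 1)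
    (hφm : ‖T φ‖ ^ 2 = m) (hx : x ∈ K) :
    m * ‖inner ℂ φ x‖ ^ 2 ≤ ‖T x‖ ^ 2 := by
  set c : ℂ := inner ℂ φ x
  have hψ : x - c • φ ∈ K := K.sub_mem hx (K.smul_mem c hφ)
  have hort : inner ℂ φ (x - c • φ) = 0 := by
    rw [inner_sub_right, inner_smul_right, inner_self_eq_norm_sq_to_K, hφ1]
    simp [c]
  have h0 := inner_map_eq_zero_of_maximizer T hT hφ hφ1 hφm hψ hort
  have hdec : T x = c • T φ + T (x - c • φ) := by simp
  rw [hdec, @norm_add_sq ℂ, inner_smul_left, h0, norm_smul, mul_pow, hφm]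
  simp only [mul_zero, map_zero, add_zero]
  nlinarith [sq_nonneg ‖T (x - c • φ)‖]

end Maximizer

/-! ### Leaving `MATE` through overlap with the worst eigenvector -/

section MATE

variable {H : Type*} [NormedAddCommGroup H] [InnerProductSpace ℂ H] [FiniteDimensional ℂ H]

lemma mem_MATE_iff_of_norm_eq_one (Heq : Submodule ℂ H) (ε : ℝ) {ψ : H} (hψ : ‖ψ‖ = 1) :
    ψ ∈ MATE Heq ε ↔ ‖ψ - Heq.starProjection ψ‖ ^ 2 ≤ ε := by
  have h := Submodule.norm_sq_eq_add_norm_sq_starProjection ψ Heq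
  rw [hψ, Submodule.starProjection_orthogonal_val] at h
  simp only [MATE, Set.mem_ofPred_eq, hψ, true_and]
  constructor <;> intro <;> linarith

lemma norm_sub_starProjection_sq_le_epsStar (Heq : Submodule ℂ H) (H₀ : Module.End ℂ H) {e : ℂ}
    {φ : H} (hφ : φ ∈ H₀.eigenspace e) (hφ1 : ‖φ‖ = 1) :
    ‖φ - Heq.starProjection φ‖ ^ 2 ≤ epsStar Heq H₀ := by
  have hne : φ ≠ 0 := by
    rintro rfl
    simp at hφ1
  have he : e ∈ spectrum ℂ H₀ :=
    (Module.End.hasEigenvalue_of_hasEigenvector ⟨hφ, hne⟩).mem_spectrum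
  -- `η = 1` is always admissible, so the infimum is over a nonempty set.
  refine le_csInf ⟨1, one_pos, fun _ _ ψ _ hψ => ⟨hψ, by simp⟩⟩ ?_
  rintro η ⟨-, hη⟩
  exact (mem_MATE_iff_of_norm_eq_one Heq η hφ1).1 (hη e he φ hφ hφ1)

lemma norm_sub_starProjection_sq_le_epsStar_mul (Heq : Submodule ℂ H) (H₀ : Module.End ℂ H)
    {e : ℂ} {x : H} (hx : x ∈ H₀.eigenspace e) :
    ‖x - Heq.starProjection x‖ ^ 2 ≤ epsStar Heq H₀ * ‖x‖ ^ 2 := by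
  rcases eq_or_ne x 0 with rfl | h0
  · simp
  have hn : ‖x‖ ≠ 0 := norm_ne_zero_iff.2 h0
  have h := norm_sub_starProjection_sq_le_epsStar Heq H₀
    ((H₀.eigenspace e).smul_mem ((‖x‖ : ℂ)⁻¹) hx) (by simp [norm_smul, hn])
  rw [map_smul, ← smul_sub, norm_smul, mul_pow, norm_inv, Complex.norm_real, norm_norm, inv_pow,
    inv_mul_le_iff₀ (by positivity), mul_comm] at h
  exact h

/-- A unit vector of a worst eigenspace leaves `MATE_ε'` once its overlap with the worst eigenvector
is large. -/
lemma notMem_MATE_of_lt (Heq : Submodule ℂ H) (H₀ : Module.End ℂ H) {e : ℂ} {φ χ : H}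
    (hφ : φ ∈ H₀.eigenspace e) (hφ1 : ‖φ‖ = 1)
    (hφm : ‖φ - Heq.starProjection φ‖ ^ 2 = epsStar Heq H₀) (hχ : χ ∈ H₀.eigenspace e)
    (hχ1 : ‖χ‖ = 1) {t ε' : ℝ} (ht : 0 ≤ t) (hε0 : 0 < ε') (hε : ε' ≤ epsStar Heq H₀ * t)
    (hlt : t < ‖inner ℂ φ χ‖ ^ 2) : χ ∉ MATE Heq ε' := by
  rw [mem_MATE_iff_of_norm_eq_one Heq ε' hχ1, not_le]
  have hpos : 0 < epsStar Heq H₀ := pos_of_mul_pos_left (hε0.trans_le hε) ht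
  have h := mul_norm_inner_sq_le_of_maximizer
    (LinearMap.id - Heq.starProjection.toLinearMap) (K := H₀.eigenspace e)
    (fun x hx => norm_sub_starProjection_sq_le_epsStar_mul Heq H₀ hx) hφ hφ1 hφm hχ
  calc ε' ≤ epsStar Heq H₀ * t := hε
    _ < epsStar Heq H₀ * ‖inner ℂ φ χ‖ ^ 2 := mul_lt_mul_of_pos_left hlt hpos
    _ ≤ _ := h

end MATE

/-! ### Overlaps of a Haar basis with a fixed vector -/

section RandomBasis

open Matrix

lemma measurableSet_exists_lt_norm_inner_sq {ι V : Type*} [Countable ι] [NormedAddCommGroup V]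
    [InnerProductSpace ℂ V] [MeasurableSpace V] [BorelSpace V] (φ : V) (t : ℝ) :
    MeasurableSet {v : ι → V | ∃ k, t < ‖inner ℂ φ (v k)‖ ^ 2} := by
  simp only [Set.ofPred_exists]
  refine MeasurableSet.iUnion fun k => measurableSet_lt measurable_const ?_
  have : Continuous fun x : V => ‖inner ℂ φ x‖ ^ 2 := by fun_prop
  exact this.measurable.comp (measurable_pi_apply k)

variable (V : Type*) [NormedAddCommGroup V] [InnerProductSpace ℂ V] [FiniteDimensional ℂ V]
  [MeasurableSpace V] [BorelSpace V]

/-- With high probability some vector of a Haar-distributed orthonormal basis has a squared overlap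
larger than `t` with a given unit vector. -/
lemma haarONB_exists_lt_norm_inner_sq {φ : V} (hφ : ‖φ‖ = 1) {t : ℝ} (ht : 0 ≤ t) :
    1 - ((2 * Real.exp (-1)) ^ Module.finrank ℂ V +
        (1 - Real.exp (-(2 * Module.finrank ℂ V * t))) ^ Module.finrank ℂ V) ≤
      (haarONB V).real {v | ∃ k, t < ‖inner ℂ φ (v k)‖ ^ 2} := by
  set b := stdOrthonormalBasis ℂ V
  set w : Fin (Module.finrank ℂ V) → ℂ := fun j => inner ℂ φ (b j)
  have hw : normSqSum w = 1 := by
    have := b.sum_sq_norm_inner_left φ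
    rw [hφ, one_pow] at this
    rw [← this]; rfl
  have hset : rotatedBasis V ⁻¹' {v | ∃ k, t < ‖inner ℂ φ (v k)‖ ^ 2} =
      {U : Matrix.unitaryGroup (Fin (Module.finrank ℂ V)) ℂ |
        w ᵥ* (U : Matrix _ (Fin (Module.finrank ℂ V)) ℂ) ∈ flatVectors _ t}ᶜ := by
    ext U
    have hk : ∀ k, inner ℂ φ (rotatedBasis V U k) =
        (w ᵥ* (U : Matrix _ (Fin (Module.finrank ℂ V)) ℂ)) k := by
      intro k
      simp only [rotatedBasis, inner_sum, inner_smul_right, vecMul, dotProduct, w, b, mul_comm]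
    simp only [Set.mem_preimage, Set.mem_compl_iff, Set.mem_ofPred_eq, flatVectors,
      normSqSum_vecMul, hw, mul_one, not_forall, not_le, hk]
  have hA : MeasurableSet {U : Matrix.unitaryGroup (Fin (Module.finrank ℂ V)) ℂ |
      w ᵥ* (U : Matrix _ (Fin (Module.finrank ℂ V)) ℂ) ∈ flatVectors _ t} :=
    (measurable_vecMul_unitary.comp (measurable_const.prodMk measurable_id))
      (measurableSet_flatVectors _ t)
  rw [haarONB, map_measureReal_apply (measurable_rotatedBasis V)
    (measurableSet_exists_lt_norm_inner_sq φ t), hset,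
    probReal_compl_eq_one_sub hA]
  exact sub_le_sub_left (haarUnitary_flat_le ht hw) 1

end RandomBasis

end RandomEigenbasis
end

theorem mainTheorem9 (δ : ℝ) (hδ0 : 0 < δ) (hδ1 : δ < 1) :
    ∃ D₀ : ℝ, 0 < D₀ ∧
      ∀ (H : Type*) [NormedAddCommGroup H] [InnerProductSpace ℂ H] [FiniteDimensional ℂ H]
        [MeasurableSpace H] [BorelSpace H]
        (Heq : Submodule ℂ H) (H₀ : Module.End ℂ H) (_ : LinearMap.IsSymmetric H₀)
        (e : ℂ) (_ : RandomEigenbasis.IsWorstEigenvalue Heq H₀ e)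
        (_ : D₀ ≤ (Module.finrank ℂ (H₀.eigenspace e) : ℝ))
        (Ω : Type*) [MeasurableSpace Ω] (P : Measure Ω) [IsProbabilityMeasure P]
        (χ : Ω → OrthonormalBasis (Fin (Module.finrank ℂ (H₀.eigenspace e))) ℂ
          (H₀.eigenspace e))
        (_ : HasLaw (fun ω k => χ ω k) (RandomEigenbasis.haarONB (H₀.eigenspace e)) P)
        (ε' : ℝ) (_ : 0 < ε')
        (_ : ε' ≤ RandomEigenbasis.epsStar Heq H₀ *
          (Real.log (δ * Module.finrank ℂ (H₀.eigenspace e)) /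
            (5 * Module.finrank ℂ (H₀.eigenspace e)))),
        1 - δ ≤ P.real {ω | ∃ k, (χ ω k : H) ∉ RandomEigenbasis.MATE Heq ε'} := by
  obtain ⟨D₀, hD₀, hbound⟩ := RandomEigenbasis.exists_forall_flat_bound_le hδ0 hδ1
  refine ⟨D₀, hD₀, ?_⟩
  intro H _ _ _ _ _ Heq H₀ _ e hworst hdim Ω _ P _ χ hlaw ε' hε0 hε
  obtain ⟨φ, hφ, hφ1, hφm⟩ := hworst
  obtain ⟨hn, hb⟩ := hbound _ hdim
  have ht := div_nonneg (Real.log_nonneg hn)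
    (by positivity : (0 : ℝ) ≤ 5 * Module.finrank ℂ (H₀.eigenspace e))
  have h := RandomEigenbasis.haarONB_exists_lt_norm_inner_sq (H₀.eigenspace e)
    (φ := ⟨φ, hφ⟩) hφ1 ht
  rw [← hlaw.map_eq, measureReal_def, Measure.map_apply_of_aemeasurable hlaw.aemeasurable
    (RandomEigenbasis.measurableSet_exists_lt_norm_inner_sq _ _), ← measureReal_def] at h
  refine ((sub_le_sub_left hb 1).trans h).trans (measureReal_mono ?_)
  rintro ω ⟨k, hk⟩
  exact ⟨k, RandomEigenbasis.notMem_MATE_of_lt Heq H₀ hφ hφ1 hφm (χ ω k).2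
    ((χ ω).orthonormal.1 k) ht hε0 hε hk⟩
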